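/- Let $R$ be a real random variable with law $P$. For $y\in\mathbb R$ the stability of $P$ at threshold $y$ is $$I_y(P)=\inf\{D_{\mathrm{KL}}(Q\,\|\,P) : Q \text{ a probability law},\ \mathbb E_Q[R]\ge y\}.$$ For $\sigma,y>0$ with $\sigma y>1$ and $\gamma\in(\tfrac12,1)$ let $\mathcal P_{\sigma,y,\gamma}$ be the class of probability laws $P$ of $R$ such that (i) $R\ge 0$ almost surely and $\mathbb E_P[e^{\sigma R}]=\infty$; (ii) $\mathbb E_P[e^{\lambda R}]\le \frac{\sigma}{\sigma-\lambda}$ for $0\le\lambda<\sigma$, and $\mathbb E_P[R]\le \frac1\sigma$; (iii) $\lambda^*(P)=\operatorname{argmax}_{\lambda\in\mathbb R}\{\lambda y-\log \mathbb E_P[e^{\lambda R}]\}\le \sigma-\frac{\gamma}{y}$. **Theorem.** Let $\gamma\in(\tfrac12,1)$, $\delta\in(0,\tfrac12)$, $\sigma,y>0$ with $\sigma y\ge 2\gamma>1$, and put $c=\frac{1}{2(1-2\delta)^2}$. If $n\in\mathbb N$ satisfies $$\log cn\ \ge\ \max\Big\{\tfrac{\sigma y}{\gamma}\Big(2\log\tfrac{\log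 cn}{\sigma}+\log\tfrac{4\sigma(\frac{\gamma}{y}\vee 1)}{1-\gamma}\Big),\ \sigma y\Big(\tfrac{2}{\gamma^2}\tfrac{\sigma y+1}{\sigma y-1}\vee\tfrac{2}{\gamma}\vee\tfrac{4}{\sigma y-1}\Big),\ \tfrac{2\sigma\log(3(1\vee\sigma^{-2}))}{1-\gamma},\ \sigma+1,\ \tfrac{2}{1-\gamma}\Big\},$$ then $$\inf_{\widehat I_n}\ \sup_{P\in\mathcal P_{\sigma,y,\gamma}}\ \mathbb P\left(\big|\widehat I_n(R_1,\dots,R_n)-I_y(P)\big|\ \ge\ \Big(\frac{\sigma y}{\log cn}\Big)^{1-\gamma}\frac{\sigma y-1}{4\,\Gamma(\gamma)\,e^{\frac{1}{\sigma y}}(\sigma y+1)(\log cn-1)}\Big(\frac{1}{cn}\Big)^{\frac{\gamma}{\sigma y}}\right)\ \ge\ \delta,$$ where $R_1,\dots,R_n$ are i.i.d. with law $P$ and the infimum is over all measurable functions $\widehat I_n$ of $(R_1,\dots,R_n)$ with values in $[-\infty,\infty]$ (in particular over all real-valued ones). -/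

import Mathlib

open MeasureTheory InformationTheory Set
open scoped ENNReal

noncomputable section

/-- The stability `I_y(P) = inf { KL(Q ‖ P) : E_Q[R] ≥ y }`, the infimum running over all probability
laws `Q` of the cost `R` on the real line, where `R` has law `P` under the data-generating
distribution. It takes values in `[0, ∞]`. -/
def stability (y : ℝ) (P : Measure ℝ) : ℝ≥0∞ :=
  ⨅ (Q : Measure ℝ)
    (_ : IsProbabilityMeasure Q ∧ Integrable (fun x : ℝ => x) Q ∧ y ≤ ∫ x, x ∂Q), klDiv Q P

/-- The moment generating function `E_P[exp (l R)]`, as a value in `[0, ∞]`. -/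
def extMgf (P : Measure ℝ) (l : ℝ) : ℝ≥0∞ :=
  ∫⁻ x, ENNReal.ofReal (Real.exp (l * x)) ∂P

/-- The dual objective `l ↦ l y - log E_P[exp (l R)]`, equal to `-∞` where the moment generating
function is infinite. -/
def dualObjective (y : ℝ) (P : Measure ℝ) (l : ℝ) : EReal :=
  ((l * y : ℝ) : EReal) - ENNReal.log (extMgf P l)

/-- `l` is the maximizer of the dual objective over the whole real line. -/
def IsDualArgmax (y : ℝ) (P : Measure ℝ) (l : ℝ) : Prop :=
  ∀ m : ℝ, m ≠ l → dualObjective y P m < dualObjective y P l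

/-- The class of laws with Gamma-like tails, with parameters `σ` (the abscissa of convergence),
threshold `y` and shape `γ`. -/
structure GammaTailClass (σ y γ : ℝ) (P : Measure ℝ) : Prop where
  isProbabilityMeasure : IsProbabilityMeasure P
  nonneg : ∀ᵐ x ∂P, 0 ≤ x
  mgf_abscissa : extMgf P σ = ⊤
  mgf_le : ∀ l : ℝ, 0 ≤ l → l < σ → extMgf P l ≤ ENNReal.ofReal (σ / (σ - l))
  mean_le : ∫⁻ x, ENNReal.ofReal x ∂P ≤ ENNReal.ofReal (1 / σ)
  argmax_le : ∃ l : ℝ, IsDualArgmax y P l ∧ l ≤ σ - γ / y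

/-- The probability, under `n` independent draws from `P`, that the estimate `est (R₁, …, Rₙ)`
of `I_y(P)` is off by at least `ε`. -/
def errorProb (n : ℕ) (y : ℝ) (P : Measure ℝ) (est : (Fin n → ℝ) → EReal) (ε : ℝ) : ℝ≥0∞ :=
  Measure.pi (fun _ : Fin n => P)
    {r | ENNReal.ofReal ε ≤ (est r - (stability y P : EReal)).abs}

/-- The minimax probability of an error of size at least `ε`: the infimum runs over all measurable
functions of the data (the values `±∞` being allowed), the supremum over the class of laws. -/
def minimaxErrorProb (n : ℕ) (σ y γ ε : ℝ) : ℝ≥0∞ :=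
  ⨅ (est : (Fin n → ℝ) → EReal) (_ : Measurable est),
    ⨆ (P : Measure ℝ) (_ : GammaTailClass σ y γ P), errorProb n y P est ε

end

/-! Le Cam's two-point method. Write `L = log (c n)` and `s = σ y`. The first law `P₀` is Gamma of
shape `γ` and rate `σ`. The second, `P₁`, moves mass `t = exp (-L) / 2 = 1 / (2 c n)` to an atom at
`L / σ`. Since `P₁ ≥ (1 - t) P₀` and `n t = (1 - 2δ)²`, a sample of size `n` cannot separate the two
laws reliably.

The stabilities nevertheless differ. If the tilt `l ≥ 0` moves the mean to `y`, the stability is the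
dual value `l y - log E exp (l R)`. Let `l = σ (1 - v)` be this tilt for `P₁`. It is only suboptimal
for `P₀`, so `I_y(P₀) - I_y(P₁)` is at least the log-ratio of the two transforms at `l`. The atom
contributes about `t exp ((1 - v) L) v ^ γ` to this ratio. As `v` is close to `γ / s`, this has
order `exp (-L γ / s) = (1 / (c n)) ^ (γ / s)`, up to the factor `v ^ γ`.

Three points need care: the atom must respect the transform bound of the class
(`contaminated_mgf_le`), the tilt must exist with `v ≥ γ / s` and `v` close to `γ / s`
(`exists_contaminated_tilt`), and the log-ratio must beat twice the stated error
(`le_log_contaminated_ratio`). -/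

/-! ### Two-point lower bound -/

/-- Product measures are monotone in their factors. -/
lemma measure_pi_mono {n : ℕ} {μ ν : Fin n → Measure ℝ} [∀ i, SigmaFinite (μ i)]
    [∀ i, SigmaFinite (ν i)] (h : ∀ i, μ i ≤ ν i) : Measure.pi μ ≤ Measure.pi ν := by
  rw [← Measure.toOuterMeasure_le]
  -- `OuterMeasure.pi` is the largest outer measure bounded by the products on boxes, so comparing
  -- boxes suffices.
  have hν : (Measure.pi ν).toOuterMeasure
      = (OuterMeasure.pi fun i => (ν i).toOuterMeasure).trim := by
    rw [Measure.pi_def, toMeasure_toOuterMeasure]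
  rw [hν, OuterMeasure.le_trim_iff]
  intro s hs
  have : (Measure.pi μ).toOuterMeasure ≤ OuterMeasure.pi fun i => (ν i).toOuterMeasure := by
    rw [OuterMeasure.le_pi]
    intro s _
    have : (Measure.pi μ).toOuterMeasure (univ.pi s) = ∏ i, μ i (s i) := Measure.pi_pi μ s
    rw [this]
    exact Finset.prod_le_prod' fun i _ => h i (s i)
  exact this s

/-- The `n`-fold power of a measure is homogeneous of degree `n`. -/
lemma measure_pi_const_smul (n : ℕ) (μ : Measure ℝ) [IsFiniteMeasure μ] {a : ℝ≥0∞} (ha : a ≠ ∞) :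
    Measure.pi (fun _ : Fin n => a • μ) = a ^ n • Measure.pi (fun _ : Fin n => μ) := by
  have : IsFiniteMeasure (a • μ) := Measure.smul_finite μ ha
  refine (Measure.pi_eq fun s _ => ?_)
  simp [Measure.pi_pi, Finset.prod_mul_distrib]

/-- Two-point bound: if `P₁` dominates `(1 - t) P₀`, with `(1 - t) ^ n ≥ δ / (1 - δ)`, and the
stabilities differ by at least `2 ε`, then no estimator beats the error probability `δ` at both. -/
lemma le_minimaxErrorProb_of_two_points {n : ℕ} {σ y γ ε δ a d₀ d₁ : ℝ} {P₀ P₁ : Measure ℝ}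
    (h₀ : GammaTailClass σ y γ P₀) (h₁ : GammaTailClass σ y γ P₁) (ha : 0 ≤ a)
    (hle : ENNReal.ofReal a • P₀ ≤ P₁)
    (hδ : δ ∈ Ioo (0 : ℝ) 1) (han : δ ≤ a ^ n * (1 - δ))
    (hs₀ : stability y P₀ = ENNReal.ofReal d₀) (hs₁ : stability y P₁ = ENNReal.ofReal d₁)
    (hd₀ : 0 ≤ d₀) (hd₁ : 0 ≤ d₁) (hd : 2 * ε ≤ |d₀ - d₁|) :
    ENNReal.ofReal δ ≤ minimaxErrorProb n σ y γ ε := by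
  have := h₀.isProbabilityMeasure
  have := h₁.isProbabilityMeasure
  refine le_iInf₂ fun est _ => ?_
  by_cases hb : ENNReal.ofReal δ ≤ errorProb n y P₀ est ε
  · exact hb.trans (le_iSup₂_of_le P₀ h₀ le_rfl)
  refine le_trans ?_ (le_iSup₂_of_le P₁ h₁ le_rfl)
  push Not at hb
  -- No estimate is within `ε` of two values `2 ε` apart; the estimates `±∞` are infinitely far from
  -- both.
  have hcov : (univ : Set (Fin n → ℝ)) ⊆
      {r | ENNReal.ofReal ε ≤ (est r - (stability y P₀ : EReal)).abs} ∪
      {r | ENNReal.ofReal ε ≤ (est r - (stability y P₁ : EReal)).abs} := by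
    intro r _
    simp only [mem_union, mem_ofPred_eq, hs₀, hs₁, EReal.coe_ennreal_ofReal, max_eq_left hd₀,
      max_eq_left hd₁]
    induction est r with
    | bot => simp
    | top => simp
    | coe x =>
      rw [← EReal.coe_sub, ← EReal.coe_sub, EReal.abs_def, EReal.abs_def]
      by_contra! hcon
      have e₀ := lt_of_not_ge fun h => hcon.1.not_ge (ENNReal.ofReal_le_ofReal h)
      have e₁ := lt_of_not_ge fun h => hcon.2.not_ge (ENNReal.ofReal_le_ofReal h)
      have := abs_sub_le d₀ x d₁
      rw [abs_sub_comm d₀ x] at this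
      linarith
  have hone : 1 ≤ errorProb n y P₀ est ε + Measure.pi (fun _ : Fin n => P₀)
      {r | ENNReal.ofReal ε ≤ (est r - (stability y P₁ : EReal)).abs} := by
    calc (1 : ℝ≥0∞) = Measure.pi (fun _ : Fin n => P₀) univ := measure_univ.symm
      _ ≤ _ := measure_mono hcov
      _ ≤ _ := measure_union_le _ _
  have hA : ENNReal.ofReal (1 - δ) ≤ Measure.pi (fun _ : Fin n => P₀)
      {r | ENNReal.ofReal ε ≤ (est r - (stability y P₁ : EReal)).abs} := by
    rw [ENNReal.ofReal_sub _ hδ.1.le, ENNReal.ofReal_one]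
    rw [tsub_le_iff_left]
    exact hone.trans (add_le_add_left hb.le _)
  calc ENNReal.ofReal δ ≤ ENNReal.ofReal (a ^ n * (1 - δ)) := ENNReal.ofReal_le_ofReal han
    _ = ENNReal.ofReal a ^ n * ENNReal.ofReal (1 - δ) := by
      rw [ENNReal.ofReal_mul (by positivity), ENNReal.ofReal_pow ha]
    _ ≤ ENNReal.ofReal a ^ n * Measure.pi (fun _ : Fin n => P₀)
      {r | ENNReal.ofReal ε ≤ (est r - (stability y P₁ : EReal)).abs} := by gcongr
    _ = Measure.pi (fun _ : Fin n => ENNReal.ofReal a • P₀)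
      {r | ENNReal.ofReal ε ≤ (est r - (stability y P₁ : EReal)).abs} := by
      rw [measure_pi_const_smul n P₀ ENNReal.ofReal_ne_top]; rfl
    _ ≤ errorProb n y P₁ est ε := by
      have : IsFiniteMeasure (ENNReal.ofReal a • P₀) := Measure.smul_finite P₀ ENNReal.ofReal_ne_top
      exact measure_pi_mono (fun _ => hle) _

/-! ### Exponential tilting and duality -/

/-- If exponential tilting by `l ≥ 0` moves the mean to `y`, the stability is the value of the dual
objective at `l`. -/
lemma stability_eq_of_tilted_mean {P : Measure ℝ} [IsProbabilityMeasure P] {l y : ℝ} (hl : 0 ≤ l)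
    (hE : Integrable (fun x => Real.exp (l * x)) P)
    (hX : Integrable (fun x => x * Real.exp (l * x)) P)
    (hm : ∫ x, x * Real.exp (l * x) ∂P = y * ∫ x, Real.exp (l * x) ∂P) :
    stability y P = ENNReal.ofReal (l * y - Real.log (∫ x, Real.exp (l * x) ∂P)) ∧
      0 ≤ l * y - Real.log (∫ x, Real.exp (l * x) ∂P) := by
  have hM : 0 < ∫ x, Real.exp (l * x) ∂P := integral_exp_pos hE
  have hprob : IsProbabilityMeasure (P.tilted fun x => l * x) := isProbabilityMeasure_tilted hE
  have hac : P.tilted (fun x => l * x) ≪ P := tilted_absolutelyContinuous P _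
  have hint : Integrable (fun x : ℝ => x) (P.tilted fun x => l * x) := by
    rw [integrable_tilted_iff hE]
    simpa [mul_comm] using hX
  have hmean : ∫ x, x ∂(P.tilted fun x => l * x) = y := by
    rw [integral_tilted]
    simp only [smul_eq_mul]
    rw [show (fun x => Real.exp (l * x) / (∫ x, Real.exp (l * x) ∂P) * x)
      = fun x => (x * Real.exp (l * x)) * (∫ x, Real.exp (l * x) ∂P)⁻¹ by ext x; ring,
      integral_mul_const, hm]
    field_simp
  have hllr : llr (P.tilted fun x => l * x) P =ᵐ[P.tilted fun x => l * x]
      fun x => l * x - Real.log (∫ x, Real.exp (l * x) ∂P) :=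
    hac.ae_le (log_rnDeriv_tilted_left_self hE)
  have hllrint : Integrable (llr (P.tilted fun x => l * x) P) (P.tilted fun x => l * x) :=
    (integrable_congr hllr).2 ((hint.const_mul l).sub (integrable_const _))
  have hkl : (klDiv (P.tilted fun x => l * x) P).toReal
      = l * y - Real.log (∫ x, Real.exp (l * x) ∂P) := by
    rw [toReal_klDiv_of_measure_eq hac (by simp), integral_congr_ae hllr,
      integral_sub (hint.const_mul l) (integrable_const _), integral_const_mul, hmean]
    simp
  refine ⟨le_antisymm ?_ ?_, hkl ▸ ENNReal.toReal_nonneg⟩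
  -- The tilted law is feasible and attains the dual value.
  · refine (iInf₂_le (P.tilted fun x => l * x) ⟨hprob, hint, hmean.ge⟩).trans ?_
    rw [← hkl, ENNReal.ofReal_toReal (klDiv_ne_top hac hllrint)]
  · refine le_iInf₂ fun Q ⟨hQ, hQi, hQy⟩ => ?_
    by_cases htop : klDiv Q P = ∞
    · simp [htop]
    obtain ⟨hQP, hQl⟩ := klDiv_ne_top_iff.1 htop
    rw [← ENNReal.ofReal_toReal htop]
    refine ENNReal.ofReal_le_ofReal ?_
    rw [toReal_klDiv_of_measure_eq hQP (by simp)]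
    -- The divergence from `P` is the nonnegative divergence from the tilted law plus `l E_Q[R] -
    -- log E_P[exp (l R)]`; then `l ≥ 0` and `E_Q[R] ≥ y` give the bound.
    have h1 := integral_llr_tilted_right hQP (hQi.const_mul l) hE hQl
    have h2 : 0 ≤ ∫ x, llr Q (P.tilted fun x => l * x) x ∂Q := by
      rw [← toReal_klDiv_of_measure_eq (hQP.trans (absolutelyContinuous_tilted hE)) (by simp)]
      exact ENNReal.toReal_nonneg
    rw [integral_const_mul] at h1
    have := mul_le_mul_of_nonneg_left hQy hl
    linarith

lemma extMgf_eq_ofReal_integral {P : Measure ℝ} {l : ℝ}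
    (hE : Integrable (fun x => Real.exp (l * x)) P) :
    extMgf P l = ENNReal.ofReal (∫ x, Real.exp (l * x) ∂P) :=
  (ofReal_integral_eq_lintegral_ofReal hE (ae_of_all _ fun _ => (Real.exp_pos _).le)).symm

lemma dualObjective_eq_coe {P : Measure ℝ} [NeZero P] {l y : ℝ}
    (hE : Integrable (fun x => Real.exp (l * x)) P) :
    dualObjective y P l = ((l * y - Real.log (∫ x, Real.exp (l * x) ∂P) : ℝ) : EReal) := by
  rw [dualObjective, extMgf_eq_ofReal_integral hE, ENNReal.log_ofReal_of_pos (integral_exp_pos hE),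
    EReal.coe_sub]

lemma integrable_exp_of_extMgf_ne_top {P : Measure ℝ} {l : ℝ} (h : extMgf P l ≠ ∞) :
    Integrable (fun x => Real.exp (l * x)) P :=
  (lintegral_ofReal_ne_top_iff_integrable (by fun_prop)
    (ae_of_all _ fun _ => (Real.exp_pos _).le)).1 h

/-- The dual objective is strictly maximal where tilting moves the mean to `y`. -/
lemma dual_lt_of_tilted_mean {P : Measure ℝ} [IsProbabilityMeasure P] {l m y : ℝ} (hml : m ≠ l)
    (hP : ¬ ∀ᵐ x ∂P, x = y)
    (hE : Integrable (fun x => Real.exp (l * x)) P)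
    (hX : Integrable (fun x => x * Real.exp (l * x)) P)
    (hm : ∫ x, x * Real.exp (l * x) ∂P = y * ∫ x, Real.exp (l * x) ∂P)
    (hEm : Integrable (fun x => Real.exp (m * x)) P) :
    m * y - Real.log (∫ x, Real.exp (m * x) ∂P) < l * y - Real.log (∫ x, Real.exp (l * x) ∂P) := by
  -- This is `exp (l x) (exp z - 1 - z)` with `z = (m - l) (x - y)`: nonnegative, and zero only at
  -- `x = y`. The tilted mean being `y`, the linear term integrates to zero.
  set f : ℝ → ℝ := fun x => Real.exp (-((m - l) * y)) * Real.exp (m * x)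
    - (Real.exp (l * x) + (m - l) * (x * Real.exp (l * x) - y * Real.exp (l * x))) with hf
  have hfac (x : ℝ) : f x
      = Real.exp (l * x) * (Real.exp ((m - l) * (x - y)) - ((m - l) * (x - y) + 1)) := by
    have : Real.exp (-((m - l) * y)) * Real.exp (m * x)
        = Real.exp (l * x) * Real.exp ((m - l) * (x - y)) := by
      rw [← Real.exp_add, ← Real.exp_add]; ring_nf
    rw [hf]; simp only [this]; ring
  have hnn (x : ℝ) : 0 ≤ f x := by
    rw [hfac]
    exact mul_nonneg (Real.exp_pos _).le (sub_nonneg.2 (Real.add_one_le_exp _))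
  have hlin : Integrable
      (fun x => (m - l) * (x * Real.exp (l * x) - y * Real.exp (l * x))) P :=
    (hX.sub (hE.const_mul y)).const_mul (m - l)
  have hadd : Integrable
      (fun x => Real.exp (l * x) + (m - l) * (x * Real.exp (l * x) - y * Real.exp (l * x))) P :=
    hE.add hlin
  have hfi : Integrable f P := (hEm.const_mul _).sub hadd
  have hval : ∫ x, f x ∂P = Real.exp (-((m - l) * y)) * (∫ x, Real.exp (m * x) ∂P)
      - ∫ x, Real.exp (l * x) ∂P := by
    rw [hf, integral_sub (hEm.const_mul _) hadd, integral_add hE hlin, integral_const_mul,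
      integral_const_mul, integral_sub hX (hE.const_mul y), integral_const_mul, hm]
    ring
  have hpos : 0 < ∫ x, f x ∂P := by
    refine lt_of_le_of_ne (integral_nonneg hnn) fun h => hP ?_
    filter_upwards [(integral_eq_zero_iff_of_nonneg hnn hfi).1 h.symm] with x hx
    by_contra hxy
    have := Real.add_one_lt_exp (mul_ne_zero (sub_ne_zero.2 hml) (sub_ne_zero.2 hxy))
    rw [hfac] at hx
    exact (mul_pos (Real.exp_pos (l * x)) (sub_pos.2 this)).ne' hx
  rw [hval, sub_pos] at hpos
  have h := Real.log_lt_log (integral_exp_pos hE) hpos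
  rw [Real.log_mul (Real.exp_ne_zero _) (integral_exp_pos hEm).ne', Real.log_exp] at h
  linarith

lemma isDualArgmax_of_tilted_mean {P : Measure ℝ} [IsProbabilityMeasure P] {l y : ℝ}
    (hP : ¬ ∀ᵐ x ∂P, x = y)
    (hE : Integrable (fun x => Real.exp (l * x)) P)
    (hX : Integrable (fun x => x * Real.exp (l * x)) P)
    (hm : ∫ x, x * Real.exp (l * x) ∂P = y * ∫ x, Real.exp (l * x) ∂P) :
    IsDualArgmax y P l := by
  intro m hml
  rw [dualObjective_eq_coe hE]
  by_cases htop : extMgf P m = ∞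
  · rw [dualObjective, htop, ENNReal.log_top, EReal.sub_top]
    exact EReal.bot_lt_coe _
  · have hEm := integrable_exp_of_extMgf_ne_top htop
    rw [dualObjective_eq_coe hEm]
    exact_mod_cast dual_lt_of_tilted_mean hml hP hE hX hm hEm

/-! ### Mean bound and Gamma integrals -/

/-- A bound on the moment generating function by that of the exponential law of rate `σ` bounds
the mean. -/
lemma lintegral_le_of_extMgf_le {P : Measure ℝ} [IsProbabilityMeasure P] {σ : ℝ} (hσ : 0 < σ)
    (hnn : ∀ᵐ x ∂P, 0 ≤ x)
    (h : ∀ l : ℝ, 0 ≤ l → l < σ → extMgf P l ≤ ENNReal.ofReal (σ / (σ - l))) :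
    ∫⁻ x, ENNReal.ofReal x ∂P ≤ ENNReal.ofReal (1 / σ) := by
  -- Compare `1 + l x ≤ exp (l x)` with `σ / (σ - l) = 1 + l / (σ - l)` and cancel; the claim
  -- follows as `l` decreases to `0`.
  have key (l : ℝ) (hl : 0 < l) (hlσ : l < σ) :
      ∫⁻ x, ENNReal.ofReal x ∂P ≤ ENNReal.ofReal (1 / (σ - l)) := by
    have hd : 0 < σ - l := sub_pos.2 hlσ
    have h1 : 1 + ENNReal.ofReal l * ∫⁻ x, ENNReal.ofReal x ∂P ≤ extMgf P l := by
      calc 1 + ENNReal.ofReal l * ∫⁻ x, ENNReal.ofReal x ∂P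
          = ∫⁻ x, (1 + ENNReal.ofReal l * ENNReal.ofReal x) ∂P := by
            rw [lintegral_add_left measurable_const, lintegral_const_mul _ (by fun_prop)]
            simp
        _ ≤ extMgf P l := by
            refine lintegral_mono_ae ?_
            filter_upwards [hnn] with x hx
            rw [← ENNReal.ofReal_mul hl.le, ← ENNReal.ofReal_one,
              ← ENNReal.ofReal_add zero_le_one (by positivity)]
            refine ENNReal.ofReal_le_ofReal ?_
            linarith [Real.add_one_le_exp (l * x)]
    have h2 := h1.trans (h l hl.le hlσ)
    have h3 : ENNReal.ofReal (σ / (σ - l)) = 1 + ENNReal.ofReal l * ENNReal.ofReal (1 / (σ - l)) := by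
      rw [← ENNReal.ofReal_mul hl.le, ← ENNReal.ofReal_one,
        ← ENNReal.ofReal_add zero_le_one (by positivity)]
      congr 1
      field_simp
      ring
    rw [h3, ENNReal.add_le_add_iff_left ENNReal.one_ne_top] at h2
    exact (ENNReal.mul_le_mul_iff_right (by simpa using hl) ENNReal.ofReal_ne_top).1 h2
  have hlim : Filter.Tendsto (fun l => ENNReal.ofReal (1 / (σ - l))) (nhdsWithin 0 (Ioi 0))
      (nhds (ENNReal.ofReal (1 / σ))) := by
    refine ENNReal.tendsto_ofReal ?_
    have : ContinuousAt (fun l : ℝ => 1 / (σ - l)) 0 :=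
      continuousAt_const.div (by fun_prop) (by simpa using hσ.ne')
    simpa using this.tendsto.mono_left nhdsWithin_le_nhds
  refine ge_of_tendsto hlim ?_
  filter_upwards [Ioo_mem_nhdsGT hσ] with l hl using key l hl.1 hl.2

open ProbabilityTheory in
lemma lintegral_gammaMeasure (a r : ℝ) {f : ℝ → ℝ≥0∞} (hf : Measurable f) :
    ∫⁻ x, f x ∂(gammaMeasure a r) = ∫⁻ x, gammaPDF a r x * f x :=
  lintegral_withDensity_eq_lintegral_mul _ (measurable_gammaPDFReal a r).ennreal_ofReal hf

open ProbabilityTheory in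
lemma ae_nonneg_gammaMeasure (a r : ℝ) : ∀ᵐ x ∂(gammaMeasure a r), 0 ≤ x := by
  rw [ae_iff]
  have : {x : ℝ | ¬ 0 ≤ x} = Iio 0 := by ext; simp
  rw [this, gammaMeasure, withDensity_apply _ measurableSet_Iio]
  exact lintegral_gammaPDF_of_nonpos le_rfl

open ProbabilityTheory in
-- Tilting turns the density of rate `r` into a multiple of the density of rate `r - l`.
lemma extMgf_gammaMeasure {a r l : ℝ} (ha : 0 < a) (hr : 0 < r) (hl : l < r) :
    extMgf (gammaMeasure a r) l = ENNReal.ofReal ((r / (r - l)) ^ a) := by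
  have hd : 0 < r - l := sub_pos.2 hl
  rw [extMgf, lintegral_gammaMeasure a r (by fun_prop)]
  have (x : ℝ) : gammaPDF a r x * ENNReal.ofReal (Real.exp (l * x))
      = ENNReal.ofReal ((r / (r - l)) ^ a) * gammaPDF a (r - l) x := by
    rcases lt_or_ge x 0 with hx | hx
    · simp [gammaPDF_of_neg hx]
    rw [gammaPDF_of_nonneg hx, gammaPDF_of_nonneg hx, ← ENNReal.ofReal_mul (by positivity),
      ← ENNReal.ofReal_mul (by positivity), Real.div_rpow hr.le hd.le, mul_assoc, ← Real.exp_add,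
      show -(r * x) + l * x = -((r - l) * x) by ring]
    have := (Real.rpow_pos_of_pos hd a).ne'
    congr 1
    field_simp
  simp_rw [this]
  rw [lintegral_const_mul' _ _ ENNReal.ofReal_ne_top,
    lintegral_gammaPDF_eq_one ha hd, mul_one]

open ProbabilityTheory in
-- The extra factor `x` raises the shape to `a + 1`.
lemma lintegral_mul_exp_gammaMeasure {a r l : ℝ} (ha : 0 < a) (hr : 0 < r) (hl : l < r) :
    ∫⁻ x, ENNReal.ofReal (x * Real.exp (l * x)) ∂(gammaMeasure a r)
      = ENNReal.ofReal (a / (r - l) * (r / (r - l)) ^ a) := by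
  have hd : 0 < r - l := sub_pos.2 hl
  rw [lintegral_gammaMeasure a r (by fun_prop)]
  have (x : ℝ) : gammaPDF a r x * ENNReal.ofReal (x * Real.exp (l * x))
      = ENNReal.ofReal (a / (r - l) * (r / (r - l)) ^ a) * gammaPDF (a + 1) (r - l) x := by
    rcases lt_or_ge x 0 with hx | hx
    · simp [gammaPDF_of_neg hx]
    rw [gammaPDF_of_nonneg hx, gammaPDF_of_nonneg hx, ← ENNReal.ofReal_mul (by positivity),
      ← ENNReal.ofReal_mul (by positivity), Real.div_rpow hr.le hd.le, Real.Gamma_add_one ha.ne',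
      Real.rpow_add_one hd.ne', add_sub_cancel_right]
    rcases hx.eq_or_lt with rfl | hx
    · simp [Real.zero_rpow ha.ne']
    rw [show Real.exp (-((r - l) * x)) = Real.exp (-(r * x)) * Real.exp (l * x) by
        rw [← Real.exp_add]; ring_nf, Real.rpow_sub_one hx.ne']
    have := (Real.rpow_pos_of_pos hd a).ne'
    have := (Real.Gamma_pos_of_pos ha).ne'
    congr 1
    field_simp
  simp_rw [this]
  rw [lintegral_const_mul' _ _ ENNReal.ofReal_ne_top,
    lintegral_gammaPDF_eq_one (by positivity) hd, mul_one]

section GammaIntegrals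

open ProbabilityTheory

variable {a r l : ℝ}

lemma integrable_exp_gammaMeasure (ha : 0 < a) (hr : 0 < r) (hl : l < r) :
    Integrable (fun x => Real.exp (l * x)) (gammaMeasure a r) :=
  integrable_exp_of_extMgf_ne_top (by simp [extMgf_gammaMeasure ha hr hl])

lemma ae_nonneg_mul_exp_gammaMeasure (a r l : ℝ) :
    0 ≤ᵐ[gammaMeasure a r] fun x => x * Real.exp (l * x) := by
  filter_upwards [ae_nonneg_gammaMeasure a r] with x hx
  exact mul_nonneg hx (Real.exp_pos _).le

lemma integrable_mul_exp_gammaMeasure (ha : 0 < a) (hr : 0 < r) (hl : l < r) :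
    Integrable (fun x => x * Real.exp (l * x)) (gammaMeasure a r) :=
  (lintegral_ofReal_ne_top_iff_integrable (by fun_prop) (ae_nonneg_mul_exp_gammaMeasure a r l)).1
    (by simp [lintegral_mul_exp_gammaMeasure ha hr hl])

lemma integral_exp_gammaMeasure (ha : 0 < a) (hr : 0 < r) (hl : l < r) :
    ∫ x, Real.exp (l * x) ∂(gammaMeasure a r) = (r / (r - l)) ^ a := by
  have hd : 0 < r - l := sub_pos.2 hl
  rw [integral_eq_lintegral_of_nonneg_ae (ae_of_all _ fun _ => (Real.exp_pos _).le) (by fun_prop)]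
  have := extMgf_gammaMeasure ha hr hl
  rw [extMgf] at this
  rw [this, ENNReal.toReal_ofReal (by positivity)]

lemma integral_mul_exp_gammaMeasure (ha : 0 < a) (hr : 0 < r) (hl : l < r) :
    ∫ x, x * Real.exp (l * x) ∂(gammaMeasure a r) = a / (r - l) * (r / (r - l)) ^ a := by
  have hd : 0 < r - l := sub_pos.2 hl
  rw [integral_eq_lintegral_of_nonneg_ae (ae_nonneg_mul_exp_gammaMeasure a r l) (by fun_prop),
    lintegral_mul_exp_gammaMeasure ha hr hl, ENNReal.toReal_ofReal (by positivity)]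

/-- The moment generating function of the Gamma law of rate `r` is infinite at `r`. -/
lemma extMgf_gammaMeasure_rate (ha : 0 < a) (hr : 0 < r) : extMgf (gammaMeasure a r) r = ∞ := by
  -- On `x ≥ 0` the transform is monotone in `l`, so its value at `r` dominates these divergent
  -- values.
  have hlim : Filter.Tendsto (fun l => ENNReal.ofReal ((r / (r - l)) ^ a)) (nhdsWithin r (Iio r))
      (nhds ∞) := by
    refine ENNReal.tendsto_ofReal_atTop.comp ((tendsto_rpow_atTop ha).comp ?_)
    refine Filter.Tendsto.const_mul_atTop hr (tendsto_inv_nhdsGT_zero.comp ?_)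
    refine tendsto_nhdsWithin_iff.2 ⟨?_, ?_⟩
    · have : ContinuousAt (fun l : ℝ => r - l) r := by fun_prop
      simpa using this.tendsto.mono_left nhdsWithin_le_nhds
    · filter_upwards [self_mem_nhdsWithin] with l hl
      exact sub_pos.2 (mem_Iio.1 hl)
  refine top_le_iff.1 (le_of_tendsto hlim ?_)
  filter_upwards [self_mem_nhdsWithin] with l hl
  rw [← extMgf_gammaMeasure ha hr hl]
  refine lintegral_mono_ae ?_
  filter_upwards [ae_nonneg_gammaMeasure a r] with x hx
  exact ENNReal.ofReal_le_ofReal (Real.exp_le_exp.2 (mul_le_mul_of_nonneg_right (le_of_lt hl) hx))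

lemma not_ae_eq_const_gammaMeasure (ha : 0 < a) (hr : 0 < r) (y : ℝ) :
    ¬ ∀ᵐ x ∂(gammaMeasure a r), x = y := by
  intro h
  have := isProbabilityMeasure_gammaMeasure ha hr
  have hac : gammaMeasure a r ≪ volume := withDensity_absolutelyContinuous _ _
  have h0 : gammaMeasure a r {y} = 0 := hac (measure_singleton y)
  have h1 : ∀ᵐ x ∂(gammaMeasure a r), x ≠ y := by
    rw [ae_iff]; simpa using h0
  obtain ⟨x, hx, hx'⟩ := (h.and h1).exists
  exact hx' hx

/-! ### The two competing laws -/

/-- The Gamma law of shape `a` and rate `r` contaminated by an atom at `x₀` of weight `t`. -/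
noncomputable def contaminatedGamma (a r t x₀ : ℝ) : Measure ℝ :=
  ENNReal.ofReal (1 - t) • gammaMeasure a r + ENNReal.ofReal t • Measure.dirac x₀

variable {t : ℝ} (x₀ : ℝ)

lemma isProbabilityMeasure_contaminatedGamma (ha : 0 < a) (hr : 0 < r) (ht : 0 ≤ t) (ht1 : t ≤ 1) :
    IsProbabilityMeasure (contaminatedGamma a r t x₀) := by
  have := isProbabilityMeasure_gammaMeasure ha hr
  refine ⟨?_⟩
  rw [contaminatedGamma]
  simp only [Measure.coe_add, Measure.coe_smul, Pi.add_apply, Pi.smul_apply, measure_univ,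
    smul_eq_mul, mul_one]
  rw [← ENNReal.ofReal_add (by linarith) ht]
  simp

lemma extMgf_contaminatedGamma (a r t x₀ l : ℝ) : extMgf (contaminatedGamma a r t x₀) l
    = ENNReal.ofReal (1 - t) * extMgf (gammaMeasure a r) l
      + ENNReal.ofReal t * ENNReal.ofReal (Real.exp (l * x₀)) := by
  rw [extMgf, contaminatedGamma, lintegral_add_measure, lintegral_smul_measure,
    lintegral_smul_measure, lintegral_dirac]
  rfl

lemma integrable_contaminatedGamma {f : ℝ → ℝ} (t : ℝ) (hf : Integrable f (gammaMeasure a r)) :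
    Integrable f (contaminatedGamma a r t x₀) :=
  (hf.smul_measure ENNReal.ofReal_ne_top).add_measure
    ((integrable_dirac (by simp)).smul_measure ENNReal.ofReal_ne_top)

lemma integral_contaminatedGamma {f : ℝ → ℝ} (hf : Integrable f (gammaMeasure a r)) (ht : 0 ≤ t)
    (ht1 : t ≤ 1) : ∫ x, f x ∂(contaminatedGamma a r t x₀)
      = (1 - t) * ∫ x, f x ∂(gammaMeasure a r) + t * f x₀ := by
  rw [contaminatedGamma, integral_add_measure (hf.smul_measure ENNReal.ofReal_ne_top)
    ((integrable_dirac (by simp)).smul_measure ENNReal.ofReal_ne_top), integral_smul_measure,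
    integral_smul_measure, integral_dirac, ENNReal.toReal_ofReal ht,
    ENNReal.toReal_ofReal (by linarith)]
  rfl

lemma smul_gammaMeasure_le_contaminatedGamma (a r t x₀ : ℝ) :
    ENNReal.ofReal (1 - t) • gammaMeasure a r ≤ contaminatedGamma a r t x₀ :=
  Measure.le_add_right le_rfl

lemma not_ae_eq_const_contaminatedGamma (ha : 0 < a) (hr : 0 < r) (ht1 : t < 1) (y : ℝ) :
    ¬ ∀ᵐ x ∂(contaminatedGamma a r t x₀), x = y := by
  intro h
  refine not_ae_eq_const_gammaMeasure ha hr y ?_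
  rw [contaminatedGamma, ae_add_measure_iff,
    Measure.ae_ennreal_smul_measure_iff (by simpa using ht1)] at h
  exact h.1

/-- The transform `(r / (r - l)) ^ a` is below `r / (r - l)` because `a ≤ 1`. The tilted mean `a /
(r - l)` equals `y` at `l = r - a / y`, so the argmax bound holds with equality. -/
lemma gammaTailClass_gammaMeasure {y : ℝ} (ha : 0 < a) (ha1 : a ≤ 1) (hr : 0 < r) (hy : 0 < y) :
    GammaTailClass r y a (gammaMeasure a r) := by
  have hp := isProbabilityMeasure_gammaMeasure ha hr
  have hmgf : ∀ l : ℝ, 0 ≤ l → l < r →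
      extMgf (gammaMeasure a r) l ≤ ENNReal.ofReal (r / (r - l)) := by
    intro l hl hlr
    rw [extMgf_gammaMeasure ha hr hlr]
    refine ENNReal.ofReal_le_ofReal ?_
    have hd : 0 < r - l := sub_pos.2 hlr
    exact Real.rpow_le_self_of_one_le ((one_le_div hd).2 (by linarith)) ha1
  have hlt : r - a / y < r := by linarith [div_pos ha hy]
  refine ⟨hp, ae_nonneg_gammaMeasure a r, extMgf_gammaMeasure_rate ha hr, hmgf,
    lintegral_le_of_extMgf_le hr (ae_nonneg_gammaMeasure a r) hmgf, r - a / y, ?_, le_rfl⟩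
  refine isDualArgmax_of_tilted_mean (not_ae_eq_const_gammaMeasure ha hr y)
    (integrable_exp_gammaMeasure ha hr hlt) (integrable_mul_exp_gammaMeasure ha hr hlt) ?_
  rw [integral_exp_gammaMeasure ha hr hlt, integral_mul_exp_gammaMeasure ha hr hlt]
  congr 1
  rw [sub_sub_cancel, div_div_cancel₀ ha.ne']

end GammaIntegrals

/-! ### Estimates in scaled variables -/

/-- Convexity between `x` and `2`, evaluated at `1`, with `Γ(1) = Γ(2) = 1`. -/
lemma one_le_Gamma_of_le_one {x : ℝ} (hx : 0 < x) (hx1 : x ≤ 1) : 1 ≤ Real.Gamma x := by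
  have hd : 0 < 2 - x := by linarith
  have ha : 0 ≤ 1 / (2 - x) := by positivity
  have hb : 0 ≤ (1 - x) / (2 - x) := div_nonneg (by linarith) hd.le
  have hab : 1 / (2 - x) + (1 - x) / (2 - x) = 1 := by field_simp; ring
  have hconv := Real.convexOn_Gamma
  have h := hconv.right (mem_Ioi.2 hx) (mem_Ioi.2 (zero_lt_two' ℝ)) ha hb hab
  have e : (1 / (2 - x)) • x + ((1 - x) / (2 - x)) • (2 : ℝ) = 1 := by
    simp only [smul_eq_mul]; field_simp; ring
  rw [e, Real.Gamma_one, Real.Gamma_two, smul_eq_mul, smul_eq_mul, mul_one, div_mul_eq_mul_div,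
    one_mul, ← add_div, le_div_iff₀ hd] at h
  linarith

lemma sq_le_four_mul_exp_half {L : ℝ} (hL : 0 ≤ L) : L ^ 2 ≤ 4 * Real.exp (L / 2) := by
  have h := Real.quadratic_le_exp_of_nonneg (x := L / 4) (by positivity)
  have h2 : L / 2 ≤ Real.exp (L / 4) := by nlinarith [sq_nonneg (L / 4 - 1)]
  have h3 : Real.exp (L / 2) = Real.exp (L / 4) * Real.exp (L / 4) := by
    rw [← Real.exp_add]; ring_nf
  rw [h3]
  nlinarith

/-- An atom of weight `exp (-L) / 2` at `L` keeps the moment generating function of the Gamma law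
of shape `γ` and rate one below that of the exponential law. -/
lemma contaminated_mgf_le {γ L u : ℝ} (hγ : γ < 1) (hL : 2 / (1 - γ) ≤ L) (hγ0 : 0 ≤ γ)
    (hu : 0 ≤ u) (hu1 : u < 1) :
    (1 - Real.exp (-L) / 2) * (1 / (1 - u)) ^ γ + Real.exp (-L) / 2 * Real.exp (u * L)
      ≤ 1 / (1 - u) := by
  have hg : 0 < 1 - γ := sub_pos.2 hγ
  have hd : 0 < 1 - u := sub_pos.2 hu1
  have hL0 : 0 < L := lt_of_lt_of_le (by positivity) hL
  have hgL : 2 ≤ (1 - γ) * L := by rwa [div_le_iff₀' hg] at hL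
  have hbern : (1 - u) ^ (1 - γ) ≤ 1 - (1 - γ) * u := by
    have := rpow_one_add_le_one_add_mul_self (s := -u) (p := 1 - γ) (by linarith) hg.le
      (by linarith)
    calc (1 - u) ^ (1 - γ) = (1 + -u) ^ (1 - γ) := by ring_nf
      _ ≤ _ := this
      _ = _ := by ring
  have hp : (1 / (1 - u)) ^ γ = (1 - u) ^ (1 - γ) / (1 - u) := by
    rw [Real.rpow_sub hd, Real.rpow_one, Real.div_rpow zero_le_one hd.le, Real.one_rpow]
    field_simp
  have hp1 : 1 ≤ (1 / (1 - u)) ^ γ :=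
    Real.one_le_rpow ((one_le_div hd).2 (by linarith)) hγ0
  -- After multiplication by `1 - u`, Bernoulli leaves room `(1 - γ) u` for the atom. For `u ≥ 1/2`
  -- use `x exp (-x) ≤ 1` at `x = (1 - u) L`; for `u ≤ 1/2` use `exp x - 1 ≤ x exp x` at `x = u L`,
  -- so that the bound vanishes linearly in `u`.
  have hmain : (1 - u) * (Real.exp (-L) / 2 * (Real.exp (u * L) - 1)) ≤ (1 - γ) * u := by
    rcases le_total (1 / 2) u with h | h
    · have h1 : (1 - u) * L * Real.exp (-((1 - u) * L)) ≤ 1 := by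
        rw [Real.exp_neg, ← div_eq_mul_inv, div_le_one (Real.exp_pos _)]
        linarith [Real.add_one_le_exp ((1 - u) * L)]
      have h2 : Real.exp (-L) * Real.exp (u * L) = Real.exp (-((1 - u) * L)) := by
        rw [← Real.exp_add]; ring_nf
      have h3 : (1 - u) * Real.exp (-((1 - u) * L)) ≤ 1 - γ := by
        have : (1 - u) * Real.exp (-((1 - u) * L)) * L ≤ (1 - γ) * L := by linarith
        exact le_of_mul_le_mul_right this hL0
      have h4 : 0 ≤ (1 - u) * Real.exp (-L) := by positivity
      calc (1 - u) * (Real.exp (-L) / 2 * (Real.exp (u * L) - 1))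
          = ((1 - u) * (Real.exp (-L) * Real.exp (u * L)) - (1 - u) * Real.exp (-L)) / 2 := by ring
        _ ≤ (1 - γ) / 2 := by rw [h2]; linarith
        _ ≤ (1 - γ) * u := by nlinarith
    · have h1 : Real.exp (u * L) - 1 ≤ u * L * Real.exp (u * L) := by
        have := Real.add_one_le_exp (-(u * L))
        rw [Real.exp_neg] at this
        have h0 := Real.exp_pos (u * L)
        have := mul_le_mul_of_nonneg_right this h0.le
        rw [inv_mul_cancel₀ h0.ne'] at this
        linarith
      have h2 : Real.exp (u * L) ≤ Real.exp (L / 2) := Real.exp_le_exp.2 (by nlinarith)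
      have h3 : Real.exp (-L) * Real.exp (L / 2) = (Real.exp (L / 2))⁻¹ := by
        rw [← Real.exp_add, ← Real.exp_neg]; ring_nf
      have h4 : L * (Real.exp (L / 2))⁻¹ ≤ 2 * (1 - γ) := by
        rw [← div_eq_mul_inv, div_le_iff₀ (Real.exp_pos _)]
        have h6 := sq_le_four_mul_exp_half hL0.le
        have h7 : L * L ≤ (2 * (1 - γ) * Real.exp (L / 2)) * L := by
          nlinarith [Real.exp_pos (L / 2)]
        exact le_of_mul_le_mul_right h7 hL0
      have h8 : 0 ≤ Real.exp (-L) / 2 * (Real.exp (u * L) - 1) :=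
        mul_nonneg (by positivity) (by linarith [Real.add_one_le_exp (u * L), mul_nonneg hu hL0.le])
      calc (1 - u) * (Real.exp (-L) / 2 * (Real.exp (u * L) - 1))
          ≤ Real.exp (-L) / 2 * (Real.exp (u * L) - 1) := mul_le_of_le_one_left h8 (by linarith)
        _ ≤ Real.exp (-L) / 2 * (u * L * Real.exp (L / 2)) := by
          have := mul_le_mul_of_nonneg_left h2 (mul_nonneg hu hL0.le)
          gcongr
          linarith
        _ = u / 2 * (L * (Real.exp (-L) * Real.exp (L / 2))) := by ring
        _ ≤ u / 2 * (2 * (1 - γ)) := by rw [h3]; gcongr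
        _ = (1 - γ) * u := by ring
  have ht : 0 < Real.exp (-L) := Real.exp_pos _
  rw [le_div_iff₀ hd]
  have h9 : (1 / (1 - u)) ^ γ * (1 - u) ≤ 1 - (1 - γ) * u := by
    rw [hp, div_mul_cancel₀ _ hd.ne']; exact hbern
  have h10 : Real.exp (-L) / 2 * (1 - u) ≤ Real.exp (-L) / 2 * (1 - u) * (1 / (1 - u)) ^ γ :=
    le_mul_of_one_le_right (by positivity) hp1
  nlinarith

/-- There is a tilt, slightly below that of the Gamma law, which gives the contaminated law mean
`s`; here `v` is one minus the tilt. -/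
lemma exists_contaminated_tilt {γ s L : ℝ} (hγ : 1 / 2 < γ) (hγ1 : γ < 1)
    (hs : 2 * γ ≤ s) (hw : 4 ≤ L * γ / s) (hL : 8 ≤ L)
    (hexp : L * Real.exp (-(L * γ / s)) ≤ 1 / (8 * (L * γ / s))) :
    ∃ v ∈ Icc (γ / s) (γ / s + 1 / (4 * L)),
      (1 - Real.exp (-L) / 2) * (γ / v * (1 / v) ^ γ)
          + Real.exp (-L) / 2 * (L * Real.exp ((1 - v) * L))
        = s * ((1 - Real.exp (-L) / 2) * (1 / v) ^ γ
          + Real.exp (-L) / 2 * Real.exp ((1 - v) * L)) := by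
  have hγ0 : 0 < γ := by linarith
  have hs0 : 0 < s := by linarith
  have hL0 : 0 < L := by linarith
  have ht : Real.exp (-L) ≤ 1 := Real.exp_le_one_iff.2 (by linarith)
  have hsL : s ≤ L := by
    rw [le_div_iff₀ hs0] at hw
    nlinarith
  -- Tilted first moment minus `s` times the transform; a zero is sought.
  set f : ℝ → ℝ := fun v => (1 - Real.exp (-L) / 2) * (1 / v) ^ γ * (γ / v - s)
    + Real.exp (-L) / 2 * ((L - s) * Real.exp ((1 - v) * L)) with hf
  have hab : γ / s ≤ γ / s + 1 / (4 * L) := by linarith [show 0 < 1 / (4 * L) by positivity]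
  have hcont : ContinuousOn f (Icc (γ / s) (γ / s + 1 / (4 * L))) := by
    have hne : ∀ v ∈ Icc (γ / s) (γ / s + 1 / (4 * L)), v ≠ 0 := fun v hv =>
      (lt_of_lt_of_le (by positivity) hv.1).ne'
    have h1 : ContinuousOn (fun v : ℝ => (1 / v) ^ γ) (Icc (γ / s) (γ / s + 1 / (4 * L))) :=
      (continuousOn_const.div continuousOn_id hne).rpow_const fun _ _ => Or.inr hγ0.le
    have h2 : ContinuousOn (fun v : ℝ => γ / v) (Icc (γ / s) (γ / s + 1 / (4 * L))) :=
      continuousOn_const.div continuousOn_id hne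
    fun_prop
  -- Here the Gamma part has mean exactly `s`, and the atom sits at `L ≥ s`.
  have hfa : 0 ≤ f (γ / s) := by
    have : γ / (γ / s) - s = 0 := by rw [div_div_cancel₀ hγ0.ne', sub_self]
    rw [hf]; simp only [this, mul_zero, zero_add]
    have := sub_nonneg.2 hsL
    positivity
  -- The shift `1 / (4 L)` lowers the Gamma mean by `s / (4 w + 1)`, which outweighs the atom's pull
  -- of at most `L exp (-w) / 2 ≤ 1 / (16 w)`. It raises `v L` by only `1/4`, so `exp (-v L)` keeps
  -- its order.
  have hfb : f (γ / s + 1 / (4 * L)) ≤ 0 := by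
    set w := L * γ / s with hwdef
    set b := γ / s + 1 / (4 * L) with hb
    have hb0 : 0 < b := by positivity
    have hb1 : b ≤ 1 := by
      have e1 : γ / s ≤ 1 / 2 := by rw [div_le_iff₀ hs0]; linarith
      have e2 : 1 / (4 * L) ≤ 1 / 2 := by
        apply one_div_le_one_div_of_le <;> linarith
      linarith
    have hbL : w ≤ b * L := by
      have : b * L = w + 1 / 4 := by rw [hb, hwdef]; field_simp
      linarith
    have e3 : γ / b - s = -(s / (4 * w + 1)) := by
      have : b = γ * (4 * w + 1) / (4 * w * s) := by
        rw [hb, hwdef]; field_simp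
      rw [this]; field_simp; ring
    have e4 : 1 ≤ (1 / b) ^ γ := Real.one_le_rpow ((one_le_div hb0).2 hb1) hγ0.le
    have e5 : Real.exp (-L) / 2 * ((L - s) * Real.exp ((1 - b) * L)) ≤ 1 / (16 * w) := by
      have h1 : Real.exp (-L) * Real.exp ((1 - b) * L) ≤ Real.exp (-w) := by
        rw [← Real.exp_add]; exact Real.exp_le_exp.2 (by linarith)
      calc Real.exp (-L) / 2 * ((L - s) * Real.exp ((1 - b) * L))
          = (L - s) / 2 * (Real.exp (-L) * Real.exp ((1 - b) * L)) := by ring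
        _ ≤ L / 2 * Real.exp (-w) := by gcongr; linarith
        _ = (L * Real.exp (-w)) / 2 := by ring
        _ ≤ 1 / (8 * w) / 2 := by gcongr
        _ = 1 / (16 * w) := by field_simp; norm_num
    have e6 : 1 / 2 * (s / (4 * w + 1))
        ≤ (1 - Real.exp (-L) / 2) * (1 / b) ^ γ * (s / (4 * w + 1)) := by
      gcongr
      nlinarith
    have e7 : 1 / (16 * w) ≤ 1 / 2 * (s / (4 * w + 1)) := by
      rw [div_mul_div_comm, div_le_div_iff₀ (by positivity) (by positivity)]
      nlinarith
    rw [hf]; simp only [e3]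
    linarith
  obtain ⟨v, hv, hv0⟩ := intermediate_value_Icc' hab hcont ⟨hfb, hfa⟩
  refine ⟨v, hv, ?_⟩
  simp only [hf] at hv0
  linarith

/-- Lower bound on the log-ratio of the moment generating functions of the contaminated and the
pure Gamma law, at tilt `1 - v`. -/
lemma le_log_contaminated_ratio {γ s L v : ℝ} (hγ : 1 / 2 < γ) (hγ1 : γ < 1)
    (hs : 2 * γ ≤ s) (hw : 4 ≤ L * γ / s) (hL : 8 ≤ L)
    (hv : v ∈ Icc (γ / s) (γ / s + 1 / (4 * L))) :
    2 * ((s / L) ^ (1 - γ) * ((s - 1) / (4 * Real.Gamma γ * Real.exp (1 / s) * (s + 1) * (L - 1)))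
        * Real.exp (-(L * γ / s)))
      ≤ Real.log ((1 - Real.exp (-L) / 2)
          + Real.exp (-L) / 2 * Real.exp ((1 - v) * L) * v ^ γ) := by
  have hγ0 : 0 < γ := by linarith
  have hs0 : 0 < s := by linarith
  have hL0 : 0 < L := by linarith
  set w := L * γ / s with hwdef
  set A := (γ / s) ^ γ with hA
  have hA0 : 0 < A := by positivity
  have hgs : γ / s ≤ 1 / 2 := by rw [div_le_iff₀ hs0]; linarith
  have hA1 : A ≤ 1 := Real.rpow_le_one (by positivity) (by linarith) hγ0.le
  have hAL : 4 / L ≤ A := by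
    have h1 : γ / s ≤ A := Real.self_le_rpow_of_le_one (by positivity) (by linarith) hγ1.le
    refine le_trans ?_ h1
    rw [div_le_iff₀ hL0]
    calc 4 ≤ w := hw
      _ = γ / s * L := by rw [hwdef]; ring
  have hv0 : 0 < v := lt_of_lt_of_le (by positivity) hv.1
  have hvL : v * L ≤ w + 1 / 4 := by
    have : (γ / s + 1 / (4 * L)) * L = w + 1 / 4 := by rw [hwdef]; field_simp
    rw [← this]
    exact mul_le_mul_of_nonneg_right hv.2 hL0.le
  have hew := Real.exp_pos (-w)
  have hexp : 3 / 4 * Real.exp (-w) ≤ Real.exp (-L) * Real.exp ((1 - v) * L) := by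
    have h1 : Real.exp (-L) * Real.exp ((1 - v) * L) = Real.exp (-w) * Real.exp (w - v * L) := by
      rw [← Real.exp_add, ← Real.exp_add]; ring_nf
    have h2 := Real.add_one_le_exp (w - v * L)
    rw [h1]
    nlinarith
  have hvA : A ≤ v ^ γ := Real.rpow_le_rpow (by positivity) hv.1 hγ0.le
  -- The mass removed from the Gamma part is negligible beside the atom's gain: `w ≤ L / 2` and `exp
  -- (-L / 2) ≤ 1 / L ≤ A / 4`.
  have ht : Real.exp (-L) ≤ 1 / 4 * (A * Real.exp (-w)) := by
    have h1 : Real.exp (-L) = Real.exp (-w) * Real.exp (-(L - w)) := by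
      rw [← Real.exp_add]; ring_nf
    have h2 : Real.exp (-(L - w)) ≤ 1 / L := by
      have hw2 : L / 2 ≤ L - w := by
        have : w = L * (γ / s) := by rw [hwdef]; ring
        nlinarith
      rw [Real.exp_neg, inv_eq_one_div]
      apply one_div_le_one_div_of_le hL0
      have := Real.quadratic_le_exp_of_nonneg (x := L / 2) (by positivity)
      have := Real.exp_le_exp.2 hw2
      nlinarith
    have h3 : 1 / L ≤ 1 / 4 * A := by linarith [show 4 / L = 4 * (1 / L) by ring]
    rw [h1]
    calc Real.exp (-w) * Real.exp (-(L - w)) ≤ Real.exp (-w) * (1 / 4 * A) := by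
          gcongr; exact h2.trans h3
      _ = _ := by ring
  have hz : 1 + 1 / 4 * (A * Real.exp (-w)) ≤ (1 - Real.exp (-L) / 2)
      + Real.exp (-L) / 2 * Real.exp ((1 - v) * L) * v ^ γ := by
    have : 3 / 4 * Real.exp (-w) * A ≤ Real.exp (-L) * Real.exp ((1 - v) * L) * v ^ γ :=
      mul_le_mul hexp hvA hA0.le (by positivity)
    linarith
  set z := 1 / 4 * (A * Real.exp (-w)) with hzdef
  have hz0 : 0 < z := by positivity
  have hz1 : z ≤ 1 / 4 := by
    have : Real.exp (-w) ≤ 1 := Real.exp_le_one_iff.2 (by linarith)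
    nlinarith
  have hlog : 4 / 5 * z ≤ Real.log (1 + z) := by
    refine le_trans ?_ (Real.one_sub_inv_le_log_of_pos (by positivity))
    have : 1 - (1 + z)⁻¹ = z / (1 + z) := by field_simp; ring
    rw [this, le_div_iff₀ (by positivity)]
    nlinarith
  refine le_trans (le_trans ?_ hlog) (Real.log_le_log (by positivity) hz)
  -- Trades the power in the stated error for the factor `A` of the log-ratio; `w ≥ 4` supplies the
  -- `1/4`.
  have hpow : (s / L) ^ (1 - γ) ≤ L / 4 * A := by
    have h1 : (s / L) ^ (1 - γ) = s / L * ((L / γ) ^ γ * A) := by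
      rw [hA, ← Real.mul_rpow (by positivity) (by positivity),
        show L / γ * (γ / s) = L / s by field_simp, Real.rpow_sub (by positivity), Real.rpow_one,
        div_eq_mul_inv (s / L), ← Real.inv_rpow (by positivity), inv_div]
    have h2 : (L / γ) ^ γ ≤ L / γ :=
      Real.rpow_le_self_of_one_le ((one_le_div hγ0).2 (by linarith)) hγ1.le
    have h3 : s / L * (L / γ) ≤ L / 4 := by
      rw [hwdef, le_div_iff₀ hs0] at hw
      rw [show s / L * (L / γ) = s / γ by field_simp, div_le_iff₀ hγ0]
      linarith
    calc (s / L) ^ (1 - γ) = s / L * ((L / γ) ^ γ * A) := h1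
      _ ≤ s / L * (L / γ * A) := by gcongr
      _ = s / L * (L / γ) * A := by ring
      _ ≤ L / 4 * A := by gcongr
  have hfrac : (s - 1) / (4 * Real.Gamma γ * Real.exp (1 / s) * (s + 1) * (L - 1))
      ≤ 1 / (4 * (L - 1)) := by
    have hG := one_le_Gamma_of_le_one hγ0 hγ1.le
    have hE : 1 ≤ Real.exp (1 / s) := Real.one_le_exp (by positivity)
    have hL1 : 0 < L - 1 := by linarith
    have h1 : 1 ≤ Real.Gamma γ * Real.exp (1 / s) := one_le_mul_of_one_le_of_one_le hG hE
    rw [div_le_div_iff₀ (by positivity) (by positivity), one_mul]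
    have h2 : s - 1 ≤ Real.Gamma γ * Real.exp (1 / s) * (s + 1) := by nlinarith
    calc (s - 1) * (4 * (L - 1)) ≤ Real.Gamma γ * Real.exp (1 / s) * (s + 1) * (4 * (L - 1)) := by
          gcongr
      _ = _ := by ring
  have hL1 : 0 < L - 1 := by linarith
  calc 2 * ((s / L) ^ (1 - γ)
        * ((s - 1) / (4 * Real.Gamma γ * Real.exp (1 / s) * (s + 1) * (L - 1))) * Real.exp (-w))
      ≤ 2 * ((L / 4 * A) * (1 / (4 * (L - 1))) * Real.exp (-w)) := by
        have h1 : (s / L) ^ (1 - γ)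
            * ((s - 1) / (4 * Real.Gamma γ * Real.exp (1 / s) * (s + 1) * (L - 1)))
            ≤ (L / 4 * A) * (1 / (4 * (L - 1))) :=
          mul_le_mul hpow hfrac (div_nonneg (by linarith) (by
            have := Real.Gamma_pos_of_pos hγ0
            positivity)) (by positivity)
        gcongr
    _ = L / (2 * (L - 1)) * z := by rw [hzdef]; field_simp; norm_num
    _ ≤ 4 / 5 * z := by
        refine mul_le_mul_of_nonneg_right ?_ hz0.le
        rw [div_le_iff₀ (by positivity)]
        linarith

/-- Consequences of the sample size conditions, in terms of `L = log (c n)` and `s = σ y`. -/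
lemma sample_size_bounds {σ y γ L : ℝ} (hσ : 0 < σ) (hy : 0 < y) (hγ : 1 / 2 < γ) (hγ1 : γ < 1)
    (hs : 2 * γ ≤ σ * y) (hL : 0 < L)
    (h1 : σ * y / γ * (2 * Real.log (L / σ) + Real.log (4 * σ * max (γ / y) 1 / (1 - γ))) ≤ L)
    (h2 : σ * y * (2 / γ) ≤ L) (h5 : 2 / (1 - γ) ≤ L) :
    4 ≤ L * γ / (σ * y) ∧ 8 ≤ L ∧
      L * Real.exp (-(L * γ / (σ * y))) ≤ 1 / (8 * (L * γ / (σ * y))) := by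
  have hγ0 : 0 < γ := by linarith
  have hg : 0 < 1 - γ := by linarith
  have hs0 : 0 < σ * y := by positivity
  set w := L * γ / (σ * y) with hw
  have hw0 : 0 < w := by positivity
  have hw2 : 2 ≤ w := by
    rw [hw, le_div_iff₀ hs0]
    calc 2 * (σ * y) = σ * y * (2 / γ) * γ := by field_simp
      _ ≤ L * γ := by gcongr
  have hL4 : 4 ≤ L := by
    refine le_trans ?_ h5
    rw [le_div_iff₀ hg]; linarith
  have hlog : Real.log ((L / σ) ^ 2 * (4 * σ * (γ / y) / (1 - γ))) ≤ w := by
    rw [Real.log_mul (by positivity) (by positivity), Real.log_pow, hw, le_div_iff₀ hs0]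
    have h6 : Real.log (4 * σ * (γ / y) / (1 - γ))
        ≤ Real.log (4 * σ * max (γ / y) 1 / (1 - γ)) := by
      apply Real.log_le_log (by positivity)
      gcongr
      exact le_max_left _ _
    calc ((2 : ℕ) * Real.log (L / σ) + Real.log (4 * σ * (γ / y) / (1 - γ))) * (σ * y)
        ≤ (2 * Real.log (L / σ) + Real.log (4 * σ * max (γ / y) 1 / (1 - γ))) * (σ * y) := by
          push_cast; gcongr
      _ = σ * y / γ * (2 * Real.log (L / σ) + Real.log (4 * σ * max (γ / y) 1 / (1 - γ))) * γ := by
          field_simp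
      _ ≤ L * γ := by gcongr
  -- The exponentiated logarithmic condition has left side `4 w L / (1 - γ)`, and `1 - γ < 1/2`.
  have hexp : 8 * w * L ≤ Real.exp w := by
    rw [Real.log_le_iff_le_exp (by positivity)] at hlog
    refine le_trans ?_ hlog
    have : (L / σ) ^ 2 * (4 * σ * (γ / y) / (1 - γ)) = 4 * w * L / (1 - γ) := by
      rw [hw]; field_simp
    rw [this, le_div_iff₀ hg]
    nlinarith [mul_pos hw0 hL]
  -- Bootstrap: `w ≥ 2` and `L ≥ 4` give `exp w ≥ 64 > exp 4`.
  have hw4 : 4 ≤ w := by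
    have h64 : Real.exp 4 ≤ Real.exp w := by
      refine le_trans ?_ (le_trans (show (64 : ℝ) ≤ 8 * w * L by nlinarith) hexp)
      have := Real.exp_one_lt_d9
      calc Real.exp 4 = Real.exp 1 ^ 4 := by rw [← Real.exp_nat_mul]; norm_num
        _ ≤ 2.8 ^ 4 := by gcongr; linarith
        _ ≤ 64 := by norm_num
    exact Real.exp_le_exp.1 h64
  refine ⟨hw4, ?_, ?_⟩
  · have : w ≤ L / 2 := by
      rw [hw, div_le_iff₀ hs0]
      nlinarith
    linarith
  · rw [Real.exp_neg, ← div_eq_mul_inv, div_le_div_iff₀ (Real.exp_pos _) (by positivity)]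
    linarith

/-! ### Class membership and conclusion -/

/-- Contaminating the Gamma law of shape `γ` and rate `σ` by an atom of weight `exp (-L) / 2` at
`L / σ` keeps it in the class, as long as the tilt that gives mean `y` is small enough. -/
lemma gammaTailClass_contaminatedGamma {σ y γ L l : ℝ} (hγ0 : 0 < γ) (hγ1 : γ < 1) (hσ : 0 < σ)
    (hL : 2 / (1 - γ) ≤ L) (hlσ : l < σ)
    (hmean : ∫ x, x * Real.exp (l * x) ∂(contaminatedGamma γ σ (Real.exp (-L) / 2) (L / σ))
      = y * ∫ x, Real.exp (l * x) ∂(contaminatedGamma γ σ (Real.exp (-L) / 2) (L / σ)))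
    (hl : l ≤ σ - γ / y) :
    GammaTailClass σ y γ (contaminatedGamma γ σ (Real.exp (-L) / 2) (L / σ)) := by
  have hL0 : 0 < L := lt_of_lt_of_le (div_pos two_pos (sub_pos.2 hγ1)) hL
  set t := Real.exp (-L) / 2 with ht
  have ht0 : 0 < t := by positivity
  have ht2 : t ≤ 1 / 2 := by
    have : Real.exp (-L) ≤ 1 := Real.exp_le_one_iff.2 (by linarith)
    linarith
  have hprob := isProbabilityMeasure_contaminatedGamma (L / σ) hγ0 hσ ht0.le (by linarith)
  have hnn : ∀ᵐ x ∂(contaminatedGamma γ σ t (L / σ)), 0 ≤ x := by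
    rw [contaminatedGamma, ae_add_measure_iff]
    refine ⟨Measure.ae_smul_measure (ae_nonneg_gammaMeasure γ σ) _, Measure.ae_smul_measure ?_ _⟩
    exact (ae_dirac_iff measurableSet_Ici).2 (by positivity)
  have hmgf : ∀ m : ℝ, 0 ≤ m → m < σ →
      extMgf (contaminatedGamma γ σ t (L / σ)) m ≤ ENNReal.ofReal (σ / (σ - m)) := by
    intro m hm hmσ
    have hd : 0 < σ - m := sub_pos.2 hmσ
    have hu := contaminated_mgf_le hγ1 hL hγ0.le (u := m / σ) (by positivity)
      ((div_lt_one hσ).2 hmσ)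
    have e1 : 1 / (1 - m / σ) = σ / (σ - m) := by
      rw [one_sub_div hσ.ne', one_div_div]
    have e2 : m / σ * L = m * (L / σ) := by ring
    rw [e1, e2, ← ht] at hu
    rw [extMgf_contaminatedGamma, extMgf_gammaMeasure hγ0 hσ hmσ,
      ← ENNReal.ofReal_mul (by linarith), ← ENNReal.ofReal_mul ht0.le,
      ← ENNReal.ofReal_add (mul_nonneg (by linarith) (by positivity)) (by positivity)]
    exact ENNReal.ofReal_le_ofReal hu
  refine ⟨hprob, hnn, ?_, hmgf, lintegral_le_of_extMgf_le hσ hnn hmgf, l, ?_, hl⟩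
  · rw [extMgf_contaminatedGamma, extMgf_gammaMeasure_rate hγ0 hσ, ENNReal.mul_top, top_add]
    simpa using by linarith
  · exact isDualArgmax_of_tilted_mean
      (not_ae_eq_const_contaminatedGamma (L / σ) hγ0 hσ (by linarith) y)
      (integrable_contaminatedGamma _ t (integrable_exp_gammaMeasure hγ0 hσ hlσ))
      (integrable_contaminatedGamma _ t (integrable_mul_exp_gammaMeasure hγ0 hσ hlσ)) hmean

theorem theorem3 (σ y γ δ : ℝ) (n : ℕ) (hσ : 0 < σ) (hy : 0 < y)
    (hγ : γ ∈ Set.Ioo (1 / 2 : ℝ) 1) (hδ : δ ∈ Set.Ioo (0 : ℝ) (1 / 2))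
    (hσy : 2 * γ ≤ σ * y)
    (c : ℝ) (hc : c = 1 / (2 * (1 - 2 * δ) ^ 2))
    (h1 : σ * y / γ * (2 * Real.log (Real.log (c * n) / σ)
      + Real.log (4 * σ * max (γ / y) 1 / (1 - γ))) ≤ Real.log (c * n))
    (h2 : σ * y * max (max (2 / γ ^ 2 * ((σ * y + 1) / (σ * y - 1))) (2 / γ)) (4 / (σ * y - 1))
      ≤ Real.log (c * n))
    (h3 : 2 * σ * Real.log (3 * max 1 (1 / σ ^ 2)) / (1 - γ) ≤ Real.log (c * n))
    (h4 : σ + 1 ≤ Real.log (c * n))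
    (h5 : 2 / (1 - γ) ≤ Real.log (c * n)) :
    ENNReal.ofReal δ ≤ minimaxErrorProb n σ y γ
      ((σ * y / Real.log (c * n)) ^ (1 - γ)
        * ((σ * y - 1) / (4 * Real.Gamma γ * Real.exp (1 / (σ * y)) * (σ * y + 1)
            * (Real.log (c * n) - 1)))
        * (1 / (c * n)) ^ (γ / (σ * y))) := by
  obtain ⟨hγ2, hγ1⟩ := hγ
  obtain ⟨hδ0, hδ2⟩ := hδ
  have hγ0 : 0 < γ := by linarith
  have hs0 : 0 < σ * y := by positivity
  have hL0 : 0 < Real.log (c * n) := by linarith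
  -- For `n = 0` the convention `Real.log 0 = 0` contradicts `L > 0`.
  have hn : n ≠ 0 := by
    rintro rfl
    simp at hL0
  have hδ1 : 0 < 1 - 2 * δ := by linarith
  have hcn : 0 < c * n := by
    have : 0 < c := by rw [hc]; positivity
    have : (0 : ℝ) < n := by exact_mod_cast Nat.pos_of_ne_zero hn
    positivity
  obtain ⟨hw, hL8, hexpw⟩ := sample_size_bounds hσ hy hγ2 hγ1 hσy hL0 h1
    (le_trans (mul_le_mul_of_nonneg_left ((le_max_right _ _).trans (le_max_left _ _)) hs0.le) h2) h5
  have hexpL : Real.exp (-Real.log (c * n)) = 1 / (c * n) := by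
    rw [Real.exp_neg, Real.exp_log hcn, one_div]
  have hpow : (1 / (c * n)) ^ (γ / (σ * y)) = Real.exp (-(Real.log (c * n) * γ / (σ * y))) := by
    rw [← hexpL, ← Real.exp_mul]; ring_nf
  rw [hpow]
  set L := Real.log (c * n) with hL
  set t := Real.exp (-L) / 2 with ht
  have ht0 : 0 < t := by positivity
  have ht2 : t ≤ 1 / 2 := by
    have : Real.exp (-L) ≤ 1 := Real.exp_le_one_iff.2 (by linarith)
    linarith
  have hgam := ProbabilityTheory.isProbabilityMeasure_gammaMeasure hγ0 hσ
  set x₀ := L / σ with hx₀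
  have hprob := isProbabilityMeasure_contaminatedGamma x₀ hγ0 hσ ht0.le (by linarith)
  obtain ⟨v, hv, hvm⟩ := exists_contaminated_tilt hγ2 hγ1 hσy hw hL8 hexpw
  rw [← ht] at hvm
  have hv0 : 0 < v := lt_of_lt_of_le (by positivity) hv.1
  have hv1 : v ≤ 1 := by
    have e1 : γ / (σ * y) ≤ 1 / 2 := by rw [div_le_iff₀ hs0]; linarith
    have e2 : 1 / (4 * L) ≤ 1 / 2 := by apply one_div_le_one_div_of_le <;> linarith
    linarith [hv.2]
  set l := σ * (1 - v) with hl
  have hl0 : 0 ≤ l := mul_nonneg hσ.le (by linarith)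
  have hlσ : l < σ := by rw [hl]; nlinarith
  have hlx : l * x₀ = (1 - v) * L := by rw [hl, hx₀]; field_simp
  have hσl : σ - l = σ * v := by rw [hl]; ring
  have hbase : σ / (σ - l) = 1 / v := by rw [hσl]; field_simp
  have hE₀ := integrable_exp_gammaMeasure hγ0 hσ hlσ
  have hX₀ := integrable_mul_exp_gammaMeasure hγ0 hσ hlσ
  have hE₁ := integrable_contaminatedGamma x₀ t hE₀
  have hX₁ := integrable_contaminatedGamma x₀ t hX₀
  have hM₁ : ∫ x, Real.exp (l * x) ∂(contaminatedGamma γ σ t x₀)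
      = (1 - t) * (1 / v) ^ γ + t * Real.exp ((1 - v) * L) := by
    rw [integral_contaminatedGamma x₀ hE₀ ht0.le (by linarith),
      integral_exp_gammaMeasure hγ0 hσ hlσ, hbase, hlx]
  have hmean : ∫ x, x * Real.exp (l * x) ∂(contaminatedGamma γ σ t x₀)
      = y * ∫ x, Real.exp (l * x) ∂(contaminatedGamma γ σ t x₀) := by
    rw [hM₁, integral_contaminatedGamma x₀ hX₀ ht0.le (by linarith),
      integral_mul_exp_gammaMeasure hγ0 hσ hlσ, hbase, hlx, hσl, hx₀]
    have e : γ / (σ * v) = γ / v / σ := by field_simp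
    rw [e]
    field_simp
    field_simp at hvm
    linarith
  have hclass : GammaTailClass σ y γ (contaminatedGamma γ σ t x₀) := by
    refine gammaTailClass_contaminatedGamma hγ0 hγ1 hσ h5 hlσ hmean ?_
    have := mul_le_mul_of_nonneg_left hv.1 hσ.le
    have e : σ * (γ / (σ * y)) = γ / y := by field_simp
    rw [hl]
    linarith
  have hlt₀ : σ - γ / y < σ := by linarith [div_pos hγ0 hy]
  have hl₀ : 0 ≤ σ - γ / y := by
    rw [sub_nonneg, div_le_iff₀ hy]; linarith
  have hmean₀ : ∫ x, x * Real.exp ((σ - γ / y) * x) ∂(ProbabilityTheory.gammaMeasure γ σ)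
      = y * ∫ x, Real.exp ((σ - γ / y) * x) ∂(ProbabilityTheory.gammaMeasure γ σ) := by
    rw [integral_exp_gammaMeasure hγ0 hσ hlt₀, integral_mul_exp_gammaMeasure hγ0 hσ hlt₀,
      sub_sub_cancel, div_div_cancel₀ hγ0.ne']
  have hE₀' := integrable_exp_gammaMeasure hγ0 hσ hlt₀
  have hX₀' := integrable_mul_exp_gammaMeasure hγ0 hσ hlt₀
  obtain ⟨hs₀, hd₀⟩ := stability_eq_of_tilted_mean hl₀ hE₀' hX₀' hmean₀
  obtain ⟨hs₁, hd₁⟩ := stability_eq_of_tilted_mean hl0 hE₁ hX₁ hmean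
  refine le_minimaxErrorProb_of_two_points (gammaTailClass_gammaMeasure hγ0 hγ1.le hσ hy) hclass
    (a := 1 - t) (by linarith) (smul_gammaMeasure_le_contaminatedGamma γ σ t x₀)
    ⟨hδ0, by linarith⟩ ?_ hs₀ hs₁ hd₀ hd₁ ?_
  · have hbern := one_add_mul_le_pow (a := -t) (by linarith) n
    -- This is what fixes `c`: Bernoulli gives `(1 - t) ^ n ≥ 4 δ (1 - δ)`, and `4 (1 - δ)² ≥ 1`
    -- finishes.
    have hnt : n * t = (1 - 2 * δ) ^ 2 := by
      rw [ht, hexpL, hc]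
      have : (n : ℝ) ≠ 0 := by exact_mod_cast hn
      field_simp
    have h7 : 4 * δ * (1 - δ) ≤ (1 - t) ^ n := by
      calc 4 * δ * (1 - δ) = 1 + n * -t := by rw [mul_neg, hnt]; ring
        _ ≤ (1 + -t) ^ n := hbern
        _ = (1 - t) ^ n := by ring_nf
    have h8 := mul_le_mul_of_nonneg_right h7 (show 0 ≤ 1 - δ by linarith)
    have h9 : 1 ≤ 4 * (1 - δ) * (1 - δ) := by nlinarith only [hδ2]
    have h10 := mul_le_mul_of_nonneg_left h9 hδ0.le
    refine le_trans ?_ h8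
    linarith only [h10]
  · refine le_trans ?_ (le_abs_self _)
    -- Evaluating the Gamma law's dual at the other law's tilt cancels `l y` and leaves the
    -- log-ratio of the transforms.
    have hmax : l * y - Real.log (∫ x, Real.exp (l * x) ∂(ProbabilityTheory.gammaMeasure γ σ))
        ≤ (σ - γ / y) * y - Real.log
          (∫ x, Real.exp ((σ - γ / y) * x) ∂(ProbabilityTheory.gammaMeasure γ σ)) := by
      rcases eq_or_ne l (σ - γ / y) with h | h
      · rw [h]
      · exact (dual_lt_of_tilted_mean h (not_ae_eq_const_gammaMeasure hγ0 hσ y) hE₀' hX₀' hmean₀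
          hE₀).le
    have hratio := le_log_contaminated_ratio hγ2 hγ1 hσy hw hL8 hv
    rw [← ht] at hratio
    have hsplit : (1 - t) * (1 / v) ^ γ + t * Real.exp ((1 - v) * L)
        = (1 / v) ^ γ * ((1 - t) + t * Real.exp ((1 - v) * L) * v ^ γ) := by
      have : (1 / v) ^ γ * v ^ γ = 1 := by
        rw [← Real.mul_rpow (by positivity) hv0.le, one_div_mul_cancel hv0.ne', Real.one_rpow]
      linear_combination (-(t * Real.exp ((1 - v) * L))) * this
    have hpos : 0 < (1 - t) + t * Real.exp ((1 - v) * L) * v ^ γ :=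
      add_pos (by linarith) (by positivity)
    rw [integral_exp_gammaMeasure hγ0 hσ hlσ, hbase] at hmax
    rw [hM₁, hsplit, Real.log_mul (by positivity) hpos.ne']
    linarith
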